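/- For an integer $n\ge 0$ let $\mathrm{inv}_2(n)$ be the number of inversions in the binary representation of $n$ (most significant digit first), that is, the number of occurrences of $10$ as a scattered (not necessarily contiguous) subsequence, counted by positions. Put $i_n = (-1)^{\mathrm{inv}_2(n)}$ and, for $N \ge 0$, $S(N) = \sum_{0\le n<N} i_n$. Then there exists a function $G:\mathbb{R}\to\mathbb{R}$ that is bounded, continuous, nowhere differentiable (differentiable at no point of $\mathbb{R}$), and periodic with period $1$, such that $$S(N) = \sqrt{N}\,G(\log_4 N)\qquad\text{for every integer } N\ge 1.$$ -/

import Mathlib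

namespace BinaryInversions

/-- The number of occurrences of the word `p` as a scattered subsequence of the base-`k`
representation of `n`, written with the most significant digit first. The list `l.sublists`
contains one entry for every set of positions in `l`, so occurrences are counted with
multiplicity. -/
def subseqCount (k : ℕ) (p : List ℕ) (n : ℕ) : ℕ :=
  (Nat.digits k n).reverse.sublists.count p

/-- The number of inversions in the binary representation of `n`: occurrences of `10` as a
scattered subsequence. -/
def inv2 (n : ℕ) : ℕ := subseqCount 2 [1, 0] n

/-- The inversion sequence `i_n = (-1) ^ inv2 n`. -/
def invSeq (n : ℕ) : ℤ := (-1) ^ inv2 n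

/-- The summatory function `S(N) = ∑_{0 ≤ n < N} i_n`. -/
def summatory (N : ℕ) : ℤ := ∑ n ∈ Finset.range N, invSeq n

end BinaryInversions

/-!
The parity of inversions obeys a two-dimensional binary recursion. Let `j n = (-1) ^ (ones n) * i n`,
where `ones n` counts the binary digits `1` of `n`. Appending the digit `1` creates no inversion,
and appending `0` creates one inversion for each `1` already present, so
`i (2n) = j n`, `i (2n+1) = i n`, `j (2n) = i n`, `j (2n+1) = -j n`.
Applied twice, this gives `i (4n), …, i (4n+3) = i n, j n, -j n, i n`, whence `S (4N) = 2 S N`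
(`summatory_four_mul`) and `|S (4N + r) - 2 S N| ≤ 2` for `r < 4`.

Consequently `2⁻ᵏ S ⌊4ᵏ x⌋` converges, at the geometric rate `2⁻ᵏ` uniformly in `x`, to a function
`limitFun` on the line. It extends `S`, it is continuous (the approximants jump by at most
`2⁻ᵏ` when `x` moves by less than `4⁻ᵏ`), and it satisfies `limitFun (4 x) = 2 limitFun x`. So
`G x = limitFun (4 ^ x) / 2 ^ x` is continuous and `1`-periodic, hence bounded.

By self-similarity, `limitFun` has an increment of absolute value exactly `2⁻ᵏ` over each
interval `[n / 4ᵏ, (n+1) / 4ᵏ]`, because `|S (n+1) - S n| = 1`. The slopes of the chords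
straddling a given point are thus `±2ᵏ`, which is incompatible with differentiability there
(`not_differentiableAt_limitFun`); a derivative of `G` would yield one of `limitFun`.
-/

namespace BinaryInversions

open Filter Topology

/-! ### Binary recursions -/

/-- The inversion sequence twisted by the Thue–Morse sequence: `(-1) ^ (ones n) * i n`, where the
number of ones in the binary representation is counted as occurrences of the word `1`. -/
def twistedSeq (n : ℕ) : ℤ := (-1) ^ subseqCount 2 [1] n * invSeq n

lemma digits_two_mul_add_one (n : ℕ) : Nat.digits 2 (2 * n + 1) = 1 :: Nat.digits 2 n := by
  rw [add_comm]
  simpa using Nat.digits_add 2 (by norm_num) 1 n (by norm_num) (Or.inl one_ne_zero)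

lemma digits_two_mul {n : ℕ} (hn : n ≠ 0) : Nat.digits 2 (2 * n) = 0 :: Nat.digits 2 n := by
  simpa using Nat.digits_add 2 (by norm_num) 0 n (by norm_num) (Or.inr hn)

/-- A subsequence `p ++ [b]` of `l ++ [a]` either lies in `l` or, when `a = b`, uses the last
position. -/
lemma count_sublists_concat (l p : List ℕ) (a b : ℕ) :
    (l ++ [a]).sublists.count (p ++ [b]) =
      l.sublists.count (p ++ [b]) + if a = b then l.sublists.count p else 0 := by
  rw [List.sublists_concat, List.count_append]
  congr 1
  split_ifs with h
  · subst h
    exact List.count_map_of_injective _ _ (List.append_left_injective [a]) _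
  · rw [List.count_eq_zero]
    simp only [List.mem_map, not_exists, not_and]
    intro x _ hx
    exact h (by simpa using (List.append_inj' hx rfl).2)

lemma count_nil_sublists (l : List ℕ) : l.sublists.count [] = 1 := by
  induction l using List.reverseRecOn with
  | nil => rfl
  | append_singleton l a ih =>
    rw [List.sublists_concat, List.count_append, ih, List.count_eq_zero.2 (by simp)]

lemma inv2_two_mul_add_one (n : ℕ) : inv2 (2 * n + 1) = inv2 n := by
  rw [inv2, subseqCount, digits_two_mul_add_one, List.reverse_cons]
  exact count_sublists_concat (Nat.digits 2 n).reverse [1] 1 0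

lemma inv2_two_mul (n : ℕ) : inv2 (2 * n) = inv2 n + subseqCount 2 [1] n := by
  rcases eq_or_ne n 0 with rfl | hn
  · simp [inv2, subseqCount]
  · have := count_sublists_concat (Nat.digits 2 n).reverse [1] 0 0
    simpa [inv2, subseqCount, digits_two_mul hn] using this

lemma ones_two_mul_add_one (n : ℕ) :
    subseqCount 2 [1] (2 * n + 1) = subseqCount 2 [1] n + 1 := by
  have := count_sublists_concat (Nat.digits 2 n).reverse [] 1 1
  rw [count_nil_sublists] at this
  rw [subseqCount, digits_two_mul_add_one, List.reverse_cons]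
  exact this

lemma ones_two_mul (n : ℕ) : subseqCount 2 [1] (2 * n) = subseqCount 2 [1] n := by
  rcases eq_or_ne n 0 with rfl | hn
  · rfl
  · have := count_sublists_concat (Nat.digits 2 n).reverse [] 0 1
    simpa [subseqCount, digits_two_mul hn] using this

lemma invSeq_two_mul_add_one (n : ℕ) : invSeq (2 * n + 1) = invSeq n := by
  rw [invSeq, inv2_two_mul_add_one, invSeq]

lemma invSeq_two_mul (n : ℕ) : invSeq (2 * n) = twistedSeq n := by
  rw [invSeq, inv2_two_mul, twistedSeq, invSeq, pow_add, mul_comm]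

lemma twistedSeq_two_mul_add_one (n : ℕ) : twistedSeq (2 * n + 1) = -twistedSeq n := by
  rw [twistedSeq, ones_two_mul_add_one, invSeq_two_mul_add_one, twistedSeq, pow_succ]
  ring

lemma twistedSeq_two_mul (n : ℕ) : twistedSeq (2 * n) = invSeq n := by
  rw [twistedSeq, ones_two_mul, invSeq_two_mul, twistedSeq, ← mul_assoc, ← mul_pow]
  simp

lemma abs_invSeq (n : ℕ) : |invSeq n| = 1 := by simp [invSeq, abs_pow]

lemma abs_twistedSeq (n : ℕ) : |twistedSeq n| = 1 := by
  rw [twistedSeq, abs_mul, abs_invSeq, abs_pow]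
  simp

lemma invSeq_four_mul (n : ℕ) : invSeq (4 * n) = invSeq n := by
  rw [show 4 * n = 2 * (2 * n) by ring, invSeq_two_mul, twistedSeq_two_mul]

lemma invSeq_four_mul_add_one (n : ℕ) : invSeq (4 * n + 1) = twistedSeq n := by
  rw [show 4 * n + 1 = 2 * (2 * n) + 1 by ring, invSeq_two_mul_add_one, invSeq_two_mul]

lemma invSeq_four_mul_add_two (n : ℕ) : invSeq (4 * n + 2) = -twistedSeq n := by
  rw [show 4 * n + 2 = 2 * (2 * n + 1) by ring, invSeq_two_mul, twistedSeq_two_mul_add_one]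

lemma invSeq_four_mul_add_three (n : ℕ) : invSeq (4 * n + 3) = invSeq n := by
  rw [show 4 * n + 3 = 2 * (2 * n + 1) + 1 by ring, invSeq_two_mul_add_one,
    invSeq_two_mul_add_one]

/-! ### The summatory function -/

lemma summatory_succ (N : ℕ) : summatory (N + 1) = summatory N + invSeq N :=
  Finset.sum_range_succ _ _

lemma summatory_four_mul (N : ℕ) : summatory (4 * N) = 2 * summatory N := by
  induction N with
  | zero => simp [summatory]
  | succ N ih =>
    rw [show 4 * (N + 1) = 4 * N + 3 + 1 by ring]
    simp only [summatory_succ, ih, invSeq_four_mul, invSeq_four_mul_add_one,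
      invSeq_four_mul_add_two, invSeq_four_mul_add_three]
    ring

lemma summatory_four_pow_mul (k N : ℕ) : summatory (4 ^ k * N) = 2 ^ k * summatory N := by
  induction k with
  | zero => simp
  | succ k ih => rw [pow_succ', mul_assoc, summatory_four_mul, ih]; ring

lemma abs_summatory_sub_two_mul_le (m : ℕ) : |summatory m - 2 * summatory (m / 4)| ≤ 2 := by
  obtain ⟨n, r, hr, rfl⟩ : ∃ n r, r < 4 ∧ m = 4 * n + r := ⟨m / 4, m % 4, by omega, by omega⟩
  have hi := abs_le.1 (abs_invSeq n).le
  have hj := abs_le.1 (abs_twistedSeq n).le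
  rw [show (4 * n + r) / 4 = n by omega]
  interval_cases r <;>
    simp only [summatory_succ, summatory_four_mul, invSeq_four_mul, invSeq_four_mul_add_one,
      invSeq_four_mul_add_two, add_zero] <;>
    rw [abs_le] <;> constructor <;> linarith

lemma abs_summatory_sub_le_one {m n : ℕ} (h₁ : m ≤ n) (h₂ : n ≤ m + 1) :
    |summatory n - summatory m| ≤ 1 := by
  obtain rfl | rfl : n = m ∨ n = m + 1 := by omega
  · simp
  · simp [summatory_succ, abs_invSeq]

/-! ### The self-similar limit function -/

/-- The rescaled summatory function `2⁻ᵏ S ⌊4ᵏ x⌋`; it vanishes for negative `x`. -/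
noncomputable def approxFun (k : ℕ) (x : ℝ) : ℝ := (summatory ⌊4 ^ k * x⌋₊ : ℝ) / 2 ^ k

/-- The bound is written in the form taken by `cauchySeq_of_le_geometric_two`. -/
lemma dist_approxFun_succ_le (x : ℝ) (k : ℕ) :
    dist (approxFun k x) (approxFun (k + 1) x) ≤ 2 / 2 / 2 ^ k := by
  have hfloor : ⌊4 ^ k * x⌋₊ = ⌊4 ^ (k + 1) * x⌋₊ / 4 := by
    rw [← Nat.floor_div_ofNat]
    congr 1
    rw [pow_succ]
    ring
  have h := abs_summatory_sub_two_mul_le ⌊4 ^ (k + 1) * x⌋₊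
  rw [← hfloor] at h
  have h' : |(summatory ⌊4 ^ (k + 1) * x⌋₊ : ℝ) - 2 * summatory ⌊4 ^ k * x⌋₊| ≤ 2 := by
    exact_mod_cast h
  rw [dist_comm, Real.dist_eq, approxFun, approxFun,
    show ∀ a b : ℝ, a / 2 ^ (k + 1) - b / 2 ^ k = (a - 2 * b) / (2 * 2 ^ k) by
      intro a b; rw [pow_succ]; field_simp,
    abs_div, abs_of_pos (by positivity : (0 : ℝ) < 2 * 2 ^ k), div_div]
  gcongr

/-- The limit of the rescaled summatory functions `2⁻ᵏ S ⌊4ᵏ x⌋`. -/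
noncomputable def limitFun (x : ℝ) : ℝ := limUnder atTop fun k => approxFun k x

lemma tendsto_approxFun (x : ℝ) : Tendsto (fun k => approxFun k x) atTop (𝓝 (limitFun x)) :=
  (cauchySeq_of_le_geometric_two (dist_approxFun_succ_le x)).tendsto_limUnder

lemma dist_approxFun_limitFun_le (k : ℕ) (x : ℝ) :
    dist (approxFun k x) (limitFun x) ≤ 2 / 2 ^ k :=
  dist_le_of_le_geometric_two_of_tendsto (dist_approxFun_succ_le x) (tendsto_approxFun x) k

lemma limitFun_natCast (N : ℕ) : limitFun N = summatory N := by
  refine tendsto_nhds_unique (tendsto_approxFun N) (tendsto_const_nhds.congr fun k => ?_)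
  have : ((4 : ℝ) ^ k * N) = ((4 ^ k * N : ℕ) : ℝ) := by push_cast; ring
  rw [approxFun, this, Nat.floor_natCast, summatory_four_pow_mul]
  push_cast
  field_simp

lemma limitFun_four_mul (x : ℝ) : limitFun (4 * x) = 2 * limitFun x := by
  refine tendsto_nhds_unique (tendsto_approxFun (4 * x))
    ((((tendsto_approxFun x).comp (tendsto_add_atTop_nat 1)).const_mul 2).congr fun k => ?_)
  simp only [Function.comp_apply, approxFun]
  rw [show (4 : ℝ) ^ (k + 1) * x = 4 ^ k * (4 * x) by ring, pow_succ]
  field_simp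

lemma limitFun_four_pow_mul (k : ℕ) (x : ℝ) : limitFun (4 ^ k * x) = 2 ^ k * limitFun x := by
  induction k with
  | zero => simp
  | succ k ih => rw [pow_succ', mul_assoc, limitFun_four_mul, ih]; ring

lemma limitFun_div_four_pow (k n : ℕ) : limitFun (n / 4 ^ k) = summatory n / 2 ^ k := by
  have h := limitFun_four_pow_mul k (n / 4 ^ k)
  rw [mul_div_cancel₀ _ (by positivity), limitFun_natCast] at h
  rw [h]
  field_simp

/-- The increments of `limitFun` along the grid of mesh `4⁻ᵏ` have absolute value `2⁻ᵏ`. -/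
lemma abs_limitFun_increment (k n : ℕ) :
    |limitFun ((n + 1 : ℕ) / 4 ^ k) - limitFun (n / 4 ^ k)| = 1 / 2 ^ k := by
  have h : |(invSeq n : ℝ)| = 1 := by exact_mod_cast abs_invSeq n
  rw [limitFun_div_four_pow, limitFun_div_four_pow, summatory_succ, ← sub_div, Int.cast_add,
    add_sub_cancel_left, abs_div, h, abs_of_pos (by positivity : (0 : ℝ) < 2 ^ k)]

lemma dist_approxFun_le {k : ℕ} {x y : ℝ} (hxy : x ≤ y) (h : y ≤ x + 1 / 4 ^ k) :
    dist (approxFun k y) (approxFun k x) ≤ 1 / 2 ^ k := by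
  have h4 : (0 : ℝ) < 4 ^ k := by positivity
  have h₁ : ⌊4 ^ k * x⌋₊ ≤ ⌊4 ^ k * y⌋₊ := Nat.floor_mono (by gcongr)
  have h₂ : ⌊4 ^ k * y⌋₊ ≤ ⌊4 ^ k * x⌋₊ + 1 := by
    rw [← Nat.lt_succ_iff, Nat.floor_lt' (by simp)]
    have := Nat.lt_floor_add_one (4 ^ k * x)
    have hy : 4 ^ k * y ≤ 4 ^ k * x + 1 := by
      calc 4 ^ k * y ≤ 4 ^ k * (x + 1 / 4 ^ k) := by gcongr
        _ = 4 ^ k * x + 1 := by field_simp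
    push_cast
    linarith
  have h₃ : |(summatory ⌊4 ^ k * y⌋₊ : ℝ) - summatory ⌊4 ^ k * x⌋₊| ≤ 1 := by
    exact_mod_cast abs_summatory_sub_le_one h₁ h₂
  rw [Real.dist_eq, approxFun, approxFun, ← sub_div, abs_div,
    abs_of_pos (by positivity : (0 : ℝ) < 2 ^ k)]
  gcongr

/-- A quantitative form of the `1/2`-Hölder continuity of `limitFun`. -/
lemma dist_limitFun_le {k : ℕ} {x y : ℝ} (h : |y - x| ≤ 1 / 4 ^ k) :
    dist (limitFun y) (limitFun x) ≤ 5 / 2 ^ k := by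
  have hxy : dist (approxFun k y) (approxFun k x) ≤ 1 / 2 ^ k := by
    have := abs_le.1 h
    rcases le_total x y with hle | hle
    · exact dist_approxFun_le hle (by linarith)
    · rw [dist_comm]
      exact dist_approxFun_le hle (by linarith)
  have hx := dist_approxFun_limitFun_le k x
  have hy := dist_approxFun_limitFun_le k y
  rw [dist_comm] at hy
  calc dist (limitFun y) (limitFun x)
      ≤ dist (limitFun y) (approxFun k y) + dist (approxFun k y) (approxFun k x)
        + dist (approxFun k x) (limitFun x) := dist_triangle4 _ _ _ _
    _ ≤ 2 / 2 ^ k + 1 / 2 ^ k + 2 / 2 ^ k := by gcongr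
    _ = 5 / 2 ^ k := by ring

lemma continuous_limitFun : Continuous limitFun := by
  rw [Metric.continuous_iff]
  intro x ε hε
  obtain ⟨k, hk⟩ := pow_unbounded_of_one_lt (5 / ε) (one_lt_two : (1 : ℝ) < 2)
  refine ⟨1 / 4 ^ k, by positivity, fun y hy => (dist_limitFun_le hy.le).trans_lt ?_⟩
  rw [div_lt_iff₀ hε] at hk
  rw [div_lt_iff₀ (by positivity)]
  linarith

lemma not_differentiableAt_limitFun {y : ℝ} (hy : 0 < y) : ¬ DifferentiableAt ℝ limitFun y := by
  intro hd
  obtain ⟨C, hC⟩ := hd.isBigO_sub.bound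
  obtain ⟨δ, hδ, hC⟩ := Metric.eventually_nhds_iff.1 hC
  -- `k` is chosen so that `4⁻ᵏ < δ` and `C < 2ᵏ`.
  obtain ⟨k, hk⟩ := pow_unbounded_of_one_lt (max (1 / δ) C) (one_lt_two : (1 : ℝ) < 2)
  have hkδ : 1 / δ < 2 ^ k := (le_max_left _ _).trans_lt hk
  have hkC : C < 2 ^ k := (le_max_right _ _).trans_lt hk
  have h2 : (0 : ℝ) < 2 ^ k := by positivity
  have h4 : (4 : ℝ) ^ k = 2 ^ k * 2 ^ k := by rw [← mul_pow]; norm_num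
  have h24 : (2 : ℝ) ^ k ≤ 4 ^ k := by gcongr; norm_num
  have hmesh : 1 / (4 : ℝ) ^ k < δ := by
    rw [div_lt_iff₀ hδ] at hkδ
    rw [div_lt_iff₀ (by positivity)]
    nlinarith
  set n := ⌊4 ^ k * y⌋₊
  have ha : (n : ℝ) / 4 ^ k ≤ y := by
    rw [div_le_iff₀' (by positivity)]
    exact Nat.floor_le (by positivity)
  have hb : y < (n + 1 : ℕ) / 4 ^ k := by
    rw [lt_div_iff₀' (by positivity)]
    rw [Nat.cast_add_one]
    exact Nat.lt_floor_add_one (4 ^ k * y)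
  have hab : ((n + 1 : ℕ) : ℝ) / 4 ^ k = n / 4 ^ k + 1 / 4 ^ k := by push_cast; ring
  have hinc := abs_limitFun_increment k n
  set a := (n : ℝ) / 4 ^ k
  set b := ((n + 1 : ℕ) : ℝ) / 4 ^ k
  have hfa := @hC a (by rw [Real.dist_eq, abs_lt]; constructor <;> linarith)
  have hfb := @hC b (by rw [Real.dist_eq, abs_lt]; constructor <;> linarith)
  rw [Real.norm_eq_abs, Real.norm_eq_abs, abs_of_nonpos (by linarith : a - y ≤ 0)] at hfa
  rw [Real.norm_eq_abs, Real.norm_eq_abs, abs_of_pos (by linarith : 0 < b - y)] at hfb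
  have hle : 1 / 2 ^ k ≤ C * (1 / 4 ^ k) := by
    calc 1 / 2 ^ k = |limitFun b - limitFun a| := hinc.symm
      _ ≤ |limitFun b - limitFun y| + |limitFun a - limitFun y| := by
        rw [abs_sub_comm (limitFun a)]
        exact abs_sub_le _ _ _
      _ ≤ C * (b - y) + C * -(a - y) := add_le_add hfb hfa
      _ = C * (1 / 4 ^ k) := by rw [hab]; ring
  rw [h4, mul_one_div, div_le_div_iff₀ h2 (by positivity)] at hle
  nlinarith

/-! ### The periodic factor -/

/-- The periodic factor `G x = limitFun (4 ^ x) / 2 ^ x`. -/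
noncomputable def periodicFactor (x : ℝ) : ℝ := limitFun (4 ^ x) / 2 ^ x

lemma limitFun_eq_sqrt_mul {y : ℝ} (hy : 0 < y) :
    limitFun y = √y * periodicFactor (Real.logb 4 y) := by
  have h4 : (4 : ℝ) ^ Real.logb 4 y = y := Real.rpow_logb (by norm_num) (by norm_num) hy
  have h2 : (2 : ℝ) ^ Real.logb 4 y = √y := by
    rw [eq_comm, Real.sqrt_eq_iff_mul_self_eq hy.le (by positivity),
      ← Real.mul_rpow (by norm_num) (by norm_num)]
    norm_num [h4]
  have := Real.sqrt_pos.2 hy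
  rw [periodicFactor, h4, h2]
  field_simp

lemma continuous_periodicFactor : Continuous periodicFactor :=
  (continuous_limitFun.comp (Real.continuous_const_rpow (by norm_num))).div
    (Real.continuous_const_rpow (by norm_num)) fun x => by positivity

lemma periodic_periodicFactor : Function.Periodic periodicFactor 1 := by
  intro x
  rw [periodicFactor, periodicFactor, Real.rpow_add_one (by norm_num),
    Real.rpow_add_one (by norm_num), mul_comm, limitFun_four_mul]
  field_simp

lemma not_differentiableAt_periodicFactor (x : ℝ) : ¬ DifferentiableAt ℝ periodicFactor x := by
  intro hd
  have hy : (0 : ℝ) < 4 ^ x := by positivity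
  refine not_differentiableAt_limitFun hy ?_
  have hlog : Real.logb 4 (4 ^ x) = x := Real.logb_rpow (by norm_num) (by norm_num)
  have hlogd : DifferentiableAt ℝ (Real.logb 4) (4 ^ x) :=
    (Real.differentiableAt_log hy.ne').div_const _
  have hcomp : DifferentiableAt ℝ (fun y => periodicFactor (Real.logb 4 y)) (4 ^ x) :=
    DifferentiableAt.comp (g := periodicFactor) (4 ^ x : ℝ) (by rwa [hlog]) hlogd
  refine ((differentiableAt_id.sqrt hy.ne').mul hcomp).congr_of_eventuallyEq ?_
  filter_upwards [lt_mem_nhds hy] with y hy using limitFun_eq_sqrt_mul hy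

end BinaryInversions

theorem mainTheorem1 :
    ∃ G : ℝ → ℝ,
      (∃ C : ℝ, ∀ x : ℝ, |G x| ≤ C) ∧
      Continuous G ∧
      (∀ x : ℝ, ¬ DifferentiableAt ℝ G x) ∧
      Function.Periodic G 1 ∧
      ∀ N : ℕ, 1 ≤ N →
        (BinaryInversions.summatory N : ℝ) = Real.sqrt (N : ℝ) * G (Real.logb 4 (N : ℝ)) := by
  open BinaryInversions in
  refine ⟨periodicFactor, ?_, continuous_periodicFactor, not_differentiableAt_periodicFactor,
    periodic_periodicFactor, fun N hN => ?_⟩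
  · obtain ⟨C, hC⟩ := (periodic_periodicFactor.isBounded_of_continuous one_ne_zero
      continuous_periodicFactor).exists_norm_le
    exact ⟨C, fun x => hC _ ⟨x, rfl⟩⟩
  · rw [← limitFun_natCast, limitFun_eq_sqrt_mul (by exact_mod_cast hN)]
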